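/- Let $M,d,j,k$ be fixed non-negative integers with $1\le d<M$, or with $d=M\ge 1$ and $j=0$. For $N\ge\max(j,k)$ let $(N^d,j)$ be the partition with $d$ parts equal to $N$ followed by one part $j$, and let $s_{(N^d,j)/(k)}(1^M)$ be the skew Schur polynomial in $M$ variables with all variables set equal to $1$; here $s_{\mu/\nu}=\det\left(h_{\mu_a-\nu_b-a+b}\right)_{a,b=1}^{n}$ for any $n$ that is at least the lengths of $\mu$ and $\nu$, where $h_m$ are the complete homogeneous symmetric polynomials ($h_m=0$ for $m<0$). Let $G$ be the Barnes function, so that $G(n)=\prod_{i=0}^{n-2} i!$ for integers $n\ge 1$, and let $\binom{a}{n}=a(a-1)\cdots(a-n+1)/n!$ for integers $a$ and $n\ge0$ (so $\binom{-1}{0}=1$). Then, as $N\to\infty$, $$ s_{(N^d,j)/(k)}(1^M)\;\sim\; N^{d(M-d)}\,\frac{G(d+1)\,G(M-d+1)}{G(M+1)}\sum_{r=0}^{\min(j,k)}\binom{M-d+j-r-1}{j-r}\binom{d+k-r-1}{k-r}. $$ The same asymptotic formula, with the same right-hand side, holds as $N\to\infty$ for the Selberg–Morris integral with $\gamma=M-d$,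 $\delta=d$ and two elementary symmetric polynomials inserted, $$ \frac{1}{N!\,(2\pi)^N}\int_{[-\pi,\pi]^N} e_k(e^{i\theta_1},\dots,e^{i\theta_N})\,e_j(e^{-i\theta_1},\dots,e^{-i\theta_N})\prod_{l=1}^{N}e^{\frac12 i\theta_l(\gamma-\delta)}\,|1+e^{i\theta_l}|^{\gamma+\delta}\prod_{1\le a<b\le N}|e^{i\theta_a}-e^{i\theta_b}|^2\,d\theta_1\cdots d\theta_N . $$ Here $f\sim g$ means that $f(N)/g(N)\to1$. -/

import Mathlib

open Filter Asymptotics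

namespace SkewSchurAsymptotics

/-- The complete homogeneous symmetric polynomial `h_n` in the variables indexed by `σ`, for an
integer index `n`, with `h_n = 0` for `n < 0`. -/
noncomputable def completeHomogeneous (σ R : Type*) [CommRing R] [Fintype σ] [DecidableEq σ]
    (n : ℤ) : MvPolynomial σ R :=
  if 0 ≤ n then MvPolynomial.hsymm σ R n.toNat else 0

/-- The skew Schur polynomial `s_{μ/ν}` in the variables indexed by `σ`, by the Jacobi-Trudi
formula `s_{μ/ν} = det (h_{μ_a - ν_b - a + b})`. A partition is given by the weakly decreasing
list of its parts; trailing zeros are allowed and parts beyond the end of the list are zero. -/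
noncomputable def skewSchur (σ R : Type*) [CommRing R] [Fintype σ] [DecidableEq σ]
    (μ ν : List ℕ) : MvPolynomial σ R :=
  Matrix.det (Matrix.of fun a b : Fin (max μ.length ν.length) =>
    completeHomogeneous σ R
      ((μ.getD a 0 : ℤ) - (ν.getD b 0 : ℤ) - ((a : ℕ) : ℤ) + ((b : ℕ) : ℤ)))

/-- The partition `(N, …, N, j)` with `d` entries `N` followed by one entry `j` (for `j ≤ N`). -/
def rectWithRow (N d j : ℕ) : List ℕ := List.replicate d N ++ [j]

/-- The Barnes function at the positive integers: `G(n) = 0! 1! ⋯ (n-2)!`, that is, `G(1) = 1`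
and `G(n+1) = Γ(n) G(n)`. -/
def barnesG (n : ℕ) : ℕ := ∏ i ∈ Finset.range (n - 1), i.factorial

/-- The weight `e^{iθ(γ-δ)/2} |1 + e^{iθ}|^{γ+δ}` of the Morris integral. For `-π < θ < π` it is
the pure Fisher-Hartwig symbol `(1 + e^{iθ})^γ (1 + e^{-iθ})^δ`. -/
noncomputable def morrisWeight (γ δ : ℕ) (θ : ℝ) : ℂ :=
  Complex.exp (Complex.I * θ * ((γ : ℂ) - δ) / 2) *
    ((‖1 + Complex.exp (Complex.I * θ)‖ ^ (γ + δ) : ℝ) : ℂ)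

/-- The Selberg-Morris integral over `[-π, π]^N` with the insertion of the elementary symmetric
polynomials `e_k(e^{iθ_1}, …, e^{iθ_N})` and `e_j(e^{-iθ_1}, …, e^{-iθ_N})`. -/
noncomputable def morrisIntegral (N γ δ k j : ℕ) : ℂ :=
  1 / ((N.factorial : ℂ) * (2 * (Real.pi : ℂ)) ^ N) *
    ∫ θ in Set.Icc (fun _ : Fin N => -Real.pi) (fun _ : Fin N => Real.pi),
      MvPolynomial.eval (fun l => Complex.exp (Complex.I * (θ l : ℂ)))
          (MvPolynomial.esymm (Fin N) ℂ k) *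
        MvPolynomial.eval (fun l => Complex.exp (-(Complex.I * (θ l : ℂ))))
          (MvPolynomial.esymm (Fin N) ℂ j) *
        (∏ l : Fin N, morrisWeight γ δ (θ l)) *
        ((∏ p : Fin N × Fin N with p.1 < p.2,
          ‖Complex.exp (Complex.I * (θ p.1 : ℂ)) - Complex.exp (Complex.I * (θ p.2 : ℂ))‖ ^ 2 : ℝ) :
            ℂ)

end SkewSchurAsymptotics

/-! Put `g = M - d`. Both quantities equal the same cofactor of the `(N+1) × (N+1)` Toeplitz matrix
`T` of the symbol `(1 - z)^g (1 - 1/z)^d`, namely the adjugate entry at `(N - k, N - j)`; that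
cofactor is computed exactly and the limit is then elementary.

Skew Schur side (`eval_one_skewSchur`): `h_n(1^M)` is the coefficient of `X^n` in `(1 - X)^(-M)`, so
the Jacobi-Trudi determinant is a minor of a triangular Toeplitz matrix. Jacobi's complementary
minor theorem (`det_mul_det_bordered`, `det_eq_adjugate_toeplitz`) turns it into a minor of the
inverse, the matrix of `(1 - X)^M`, which is a cofactor of `T` up to sign.

Integral side (`morrisIntegral_eq`): an elementary symmetric polynomial times a Vandermonde
determinant is a Vandermonde determinant with one exponent skipped, so Andréief's identity gives the
determinant of the moment matrix with one row and one column removed.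

The cofactor: after diagonal scaling, `T` factors as lower triangular times diagonal times upper
triangular (`signedToeplitz_factorization`). This yields its determinant and its inverse. The
determinant supplies the power of `N` and the Barnes factors. Near the bottom right corner only
`min(j,k) + 1` terms of the inverse survive, each with a prefactor tending to `1`. -/

namespace SkewSchurAsymptotics

open Finset Matrix

/-! ### Triangular Toeplitz matrices and power series. -/

section Toeplitz

variable {R : Type*} [CommRing R]

/-- The coefficient of a power series at an integer index, zero at negative indices. -/
noncomputable def coeffInt (f : PowerSeries R) (n : ℤ) : R :=
  if 0 ≤ n then PowerSeries.coeff n.toNat f else 0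

lemma coeffInt_of_neg (f : PowerSeries R) {n : ℤ} (hn : n < 0) : coeffInt f n = 0 :=
  if_neg (not_le.mpr hn)

lemma coeffInt_natCast (f : PowerSeries R) (n : ℕ) :
    coeffInt f (n : ℤ) = PowerSeries.coeff n f := by
  simp [coeffInt]

lemma coeffInt_one (n : ℤ) : coeffInt (1 : PowerSeries R) n = if n = 0 then 1 else 0 := by
  rcases lt_or_ge n 0 with h | h
  · rw [coeffInt_of_neg _ h, if_neg h.ne]
  · lift n to ℕ using h
    rw [coeffInt_natCast, PowerSeries.coeff_one]
    simp

lemma coeffInt_mul_one_sub_X (f : PowerSeries R) (n : ℤ) :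
    coeffInt (f * (1 - PowerSeries.X)) n = coeffInt f n - coeffInt f (n - 1) := by
  rcases lt_or_ge n 0 with h | h
  · rw [coeffInt_of_neg _ h, coeffInt_of_neg _ h, coeffInt_of_neg _ (by omega), sub_zero]
  · lift n to ℕ using h
    rcases n with _ | n
    · rw [coeffInt_of_neg _ (show ((0 : ℕ) : ℤ) - 1 < 0 by norm_num), coeffInt_natCast,
        coeffInt_natCast, mul_sub, mul_one]
      simp
    · rw [show ((n + 1 : ℕ) : ℤ) - 1 = (n : ℤ) by push_cast; ring, coeffInt_natCast,
        coeffInt_natCast, coeffInt_natCast, mul_sub, mul_one, map_sub,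
        PowerSeries.coeff_succ_mul_X]

/-- Only `b ≤ m ≤ a` contributes, so cutting the Cauchy product at `n > a` loses nothing. This makes
finite lower triangular Toeplitz matrices multiply like their power series. -/
lemma sum_coeffInt_mul_coeffInt (f g : PowerSeries R) {n a : ℕ} (b : ℕ) (ha : a < n) :
    ∑ m ∈ range n, coeffInt f ((a : ℤ) - m) * coeffInt g ((m : ℤ) - b) =
      coeffInt (f * g) ((a : ℤ) - b) := by
  rcases lt_or_ge a b with h | h
  · rw [coeffInt_of_neg _ (by omega)]
    refine sum_eq_zero fun m _ => ?_
    rcases lt_or_ge m b with h' | h'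
    · rw [coeffInt_of_neg g (by omega), mul_zero]
    · rw [coeffInt_of_neg f (by omega), zero_mul]
  · obtain ⟨c, rfl⟩ := Nat.exists_eq_add_of_le h
    have hsub : Ico b (b + c + 1) ⊆ range n := by
      intro m hm
      rw [mem_Ico] at hm
      rw [mem_range]
      omega
    rw [← sum_subset hsub, sum_Ico_eq_sum_range,
      show ((b + c : ℕ) : ℤ) - b = (c : ℤ) by push_cast; ring, coeffInt_natCast, mul_comm f g,
      PowerSeries.coeff_mul, Nat.sum_antidiagonal_eq_sum_range_succ
        (fun i l => PowerSeries.coeff i g * PowerSeries.coeff l f),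
      show b + c + 1 - b = c + 1 by omega]
    · refine sum_congr rfl fun i hi => ?_
      rw [mem_range] at hi
      rw [show ((b + c : ℕ) : ℤ) - ((b + i : ℕ) : ℤ) = ((c - i : ℕ) : ℤ) by omega,
        show ((b + i : ℕ) : ℤ) - b = (i : ℤ) by omega, coeffInt_natCast, coeffInt_natCast,
        mul_comm]
    · intro m _ hm
      rw [mem_Ico, not_and_or] at hm
      rcases hm with hm | hm
      · rw [coeffInt_of_neg g (by omega), mul_zero]
      · rw [coeffInt_of_neg f (by omega), zero_mul]

/-- The lower triangular Toeplitz matrix of a power series. -/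
noncomputable def lowerToeplitz (f : PowerSeries R) (n : ℕ) : Matrix (Fin n) (Fin n) R :=
  Matrix.of fun a b => coeffInt f ((a : ℕ) - (b : ℕ) : ℤ)

lemma lowerToeplitz_mul (f g : PowerSeries R) (n : ℕ) :
    lowerToeplitz f n * lowerToeplitz g n = lowerToeplitz (f * g) n := by
  ext a b
  rw [Matrix.mul_apply]
  simp only [lowerToeplitz, Matrix.of_apply]
  rw [← sum_coeffInt_mul_coeffInt f g (b : ℕ) a.2]
  exact Fin.sum_univ_eq_sum_range
    (fun m : ℕ => coeffInt f ((a : ℕ) - (m : ℕ) : ℤ) * coeffInt g ((m : ℕ) - (b : ℕ) : ℤ)) n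

lemma lowerToeplitz_one (n : ℕ) : lowerToeplitz (1 : PowerSeries R) n = 1 := by
  ext a b
  simp only [lowerToeplitz, Matrix.of_apply, coeffInt_one, Matrix.one_apply, Fin.ext_iff,
    sub_eq_zero, Nat.cast_inj]

lemma det_lowerToeplitz (f : PowerSeries R) (hf : PowerSeries.coeff 0 f = 1) (n : ℕ) :
    (lowerToeplitz f n).det = 1 := by
  rw [Matrix.det_of_isLowerTriangular]
  · refine prod_eq_one fun i _ => ?_
    rw [lowerToeplitz, Matrix.of_apply, sub_self, ← hf]
    exact coeffInt_natCast f 0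
  · intro i l hil
    exact coeffInt_of_neg _ (by have : (i : ℕ) < l := hil; omega)

end Toeplitz

/-! ### Adjugates under inversion and sign changes. -/

section Sign

variable {R : Type*} [CommRing R] {n : Type*} [Fintype n] [DecidableEq n]

lemma adjugate_eq_of_mul_eq_one {A B : Matrix n n R} (h : A * B = 1) :
    A.adjugate = A.det • B := by
  rw [← mul_one A.adjugate, ← h, ← mul_assoc, adjugate_mul, smul_mul_assoc, one_mul]

lemma adjugate_conj_sign (A : Matrix n n R) (s : n → R) (hs : ∀ i, s i * s i = 1) :
    (Matrix.of fun a b => s a * A a b * s b).adjugate =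
      Matrix.of fun a b => s a * A.adjugate a b * s b := by
  have hD : Matrix.diagonal s * Matrix.diagonal s = 1 := by
    rw [diagonal_mul_diagonal]
    simp [hs]
  have hdet : (Matrix.diagonal s).det * (Matrix.diagonal s).det = 1 := by
    rw [← det_mul, hD, det_one]
  have e : ∀ B : Matrix n n R, (Matrix.of fun a b => s a * B a b * s b) =
      Matrix.diagonal s * B * Matrix.diagonal s := by
    intro B
    ext a b
    rw [mul_diagonal, diagonal_mul, Matrix.of_apply]
  rw [e, e, adjugate_mul_distrib, adjugate_mul_distrib, adjugate_eq_of_mul_eq_one hD,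
    smul_mul_assoc, mul_smul_comm, mul_smul_comm, smul_smul, hdet, one_smul, mul_assoc]

end Sign

/-! ### LDU factorization of the Toeplitz matrix, its determinant and its adjugate. -/

section Factorization

lemma coeffInt_one_sub_X_pow (m n : ℕ) :
    coeffInt ((1 - PowerSeries.X : PowerSeries ℝ) ^ m) (n : ℤ) = (-1) ^ n * (m.choose n : ℝ) := by
  induction m generalizing n with
  | zero =>
    rw [pow_zero, coeffInt_one]
    rcases n with _ | n
    · simp
    · rw [if_neg (by omega)]
      simp
  | succ m ih =>
    rw [pow_succ, coeffInt_mul_one_sub_X, ih]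
    rcases n with _ | n
    · rw [coeffInt_of_neg _ (show ((0 : ℕ) : ℤ) - 1 < 0 by norm_num)]
      simp
    · rw [show ((n + 1 : ℕ) : ℤ) - 1 = (n : ℤ) by push_cast; ring, ih, Nat.choose_succ_succ]
      push_cast
      ring

/-- The sum `∑ r, (-1)^(a+b) C(g, a-r) C(d, b-r) C(m+r, r)`. -/
noncomputable def tripleSum (n m g d : ℕ) (a b : ℤ) : ℝ :=
  ∑ r ∈ range n, coeffInt ((1 - PowerSeries.X : PowerSeries ℝ) ^ g) (a - r) *
    coeffInt ((1 - PowerSeries.X : PowerSeries ℝ) ^ d) (b - r) * ((m + r).choose r : ℝ)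

lemma tripleSum_eq_zero (n m g d : ℕ) {a b : ℤ} (h : a < 0 ∨ b < 0) :
    tripleSum n m g d a b = 0 := by
  refine sum_eq_zero fun r _ => ?_
  rcases h with h | h
  · rw [coeffInt_of_neg _ (show a - r < 0 by omega), zero_mul, zero_mul]
  · rw [coeffInt_of_neg _ (show b - r < 0 by omega), mul_zero, zero_mul]

lemma tripleSum_succ_left (n m g d : ℕ) (a b : ℤ) :
    tripleSum n m (g + 1) d a b = tripleSum n m g d a b - tripleSum n m g d (a - 1) b := by
  rw [tripleSum, tripleSum, tripleSum, ← sum_sub_distrib]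
  refine sum_congr rfl fun r _ => ?_
  rw [pow_succ, coeffInt_mul_one_sub_X, show a - 1 - (r : ℤ) = a - r - 1 by ring]
  ring

/-- Pascal's rule on `C(m+1+r, r)`, followed by the shift `r ↦ r + 1`. The bound `a < n` makes the
last term of the shifted sum vanish. -/
lemma tripleSum_succ_top (n m g d : ℕ) (a b : ℤ) (ha : a < n) :
    tripleSum n (m + 1) g d a b =
      tripleSum n m g d a b + tripleSum n (m + 1) g d (a - 1) (b - 1) := by
  rcases n with _ | n
  · simp [tripleSum]
  · rw [tripleSum, tripleSum, tripleSum, sum_range_succ', sum_range_succ' _ n,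
      sum_range_succ _ n, coeffInt_of_neg _ (show a - 1 - (n : ℤ) < 0 by push_cast at ha; omega)]
    have h : ∀ r : ℕ, ((m + 1 + (r + 1)).choose (r + 1) : ℝ) =
        ((m + (r + 1)).choose (r + 1) : ℝ) + ((m + 1 + r).choose r : ℝ) := by
      intro r
      rw [show m + 1 + (r + 1) = (m + (r + 1)) + 1 by ring, Nat.choose_succ_succ,
        show m + (r + 1) = m + 1 + r by ring]
      push_cast
      ring
    simp only [h, mul_add, sum_add_distrib, Nat.cast_add, Nat.cast_one]
    have e : ∀ (x : ℤ) (r : ℕ), x - 1 - (r : ℤ) = x - ((r : ℤ) + 1) := fun x r => by ring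
    simp only [e]
    simp
    ring

/-- The binomial identity behind the factorization. For `g = 0` only `r = a` survives; the induction
on `g`, then on `a`, combines `tripleSum_succ_top` and `tripleSum_succ_left` and matches Pascal's
rule on the right. -/
lemma tripleSum_eq (n g d a b : ℕ) (ha : a < n) :
    tripleSum n (g + d) g d a b =
      (-1) ^ (a + b) * ((d + a).choose b : ℝ) * ((g + b).choose a : ℝ) := by
  induction g generalizing a b with
  | zero =>
    rw [tripleSum, sum_eq_single a]
    · rw [pow_zero, sub_self, coeffInt_one, if_pos rfl, one_mul, zero_add, zero_add]
      rcases lt_or_ge b a with h | h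
      · rw [coeffInt_of_neg _ (by omega), Nat.choose_eq_zero_of_lt h]
        simp
      · obtain ⟨c, rfl⟩ := Nat.exists_eq_add_of_le h
        rw [show ((a + c : ℕ) : ℤ) - a = (c : ℤ) by push_cast; ring, coeffInt_one_sub_X_pow]
        have h1 : (d + a).choose (a + c) * (a + c).choose a = (d + a).choose a * d.choose c := by
          by_cases hc : c ≤ d
          · have := Nat.choose_mul (n := d + a) (k := a + c) (s := a) (by omega)
            rw [this, show d + a - a = d by omega, show a + c - a = c by omega]
          · rw [Nat.choose_eq_zero_of_lt (show d + a < a + c by omega),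
              Nat.choose_eq_zero_of_lt (show d < c by omega)]
            simp
        have h2 : ((d + a).choose (a + c) : ℝ) * ((a + c).choose a : ℝ) =
            ((d + a).choose a : ℝ) * (d.choose c : ℝ) := by exact_mod_cast h1
        rw [mul_assoc _ _ (((a + c).choose a : ℕ) : ℝ), h2, ← add_assoc, pow_add, ← two_mul,
          pow_mul]
        norm_num
        ring
    · intro r _ hr
      rw [pow_zero, coeffInt_one, if_neg (by omega), zero_mul, zero_mul]
    · intro h
      exact absurd (mem_range.mpr ha) h
  | succ g ih =>
    induction a generalizing b with
    | zero =>
      rw [show g + 1 + d = g + d + 1 by ring, tripleSum_succ_top _ _ _ _ _ _ (by exact_mod_cast ha),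
        tripleSum_eq_zero _ (g + d + 1) _ _ (Or.inl (by norm_num)), tripleSum_succ_left,
        tripleSum_eq_zero _ _ _ _ (a := ((0 : ℕ) : ℤ) - 1) (Or.inl (by norm_num)), ih _ _ ha]
      simp
    | succ a iha =>
      have e : ((a + 1 : ℕ) : ℤ) - 1 = (a : ℤ) := by push_cast; ring
      rw [show g + 1 + d = g + d + 1 by ring, tripleSum_succ_top _ _ _ _ _ _ (by exact_mod_cast ha),
        tripleSum_succ_left, e, ih _ _ ha, ih _ _ (by omega)]
      rcases b with _ | b
      · rw [tripleSum_eq_zero _ _ _ _ (Or.inr (by norm_num))]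
        rw [show g + 1 + 0 = g + 0 + 1 by ring, Nat.choose_succ_succ]
        simp only [Nat.choose_zero_right, Nat.succ_eq_add_one, add_zero]
        push_cast
        ring
      · rw [show ((b + 1 : ℕ) : ℤ) - 1 = (b : ℤ) by push_cast; ring,
          show g + d + 1 = g + 1 + d by ring, iha _ (by omega),
          show g + 1 + (b + 1) = g + (b + 1) + 1 by ring, Nat.choose_succ_succ (g + (b + 1)) a,
          show d + (a + 1) = d + a + 1 by ring, Nat.choose_succ_succ (d + a) b,
          show g + 1 + b = g + (b + 1) by ring]
        push_cast
        ring

/-- The product `(n + 1) ⋯ (n + g)`. -/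
noncomputable def risingProd (g n : ℕ) : ℝ := ((n + 1).ascFactorial g : ℝ)

lemma risingProd_pos (g n : ℕ) : 0 < risingProd g n := by
  rw [risingProd]
  exact_mod_cast Nat.ascFactorial_pos n g

lemma risingProd_eq (g n : ℕ) : risingProd g n = ((n + g).factorial : ℝ) / n.factorial := by
  rw [eq_div_iff (by positivity), risingProd, mul_comm]
  exact_mod_cast Nat.factorial_mul_ascFactorial n g

/-- The binomial coefficient `C(g + d, d + a - b)`, zero for `d + a < b`. -/
noncomputable def shiftedChoose (g d a b : ℕ) : ℝ :=
  if b ≤ d + a then ((g + d).choose (d + a - b) : ℝ) else 0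

/-- Diagonal scaling turns a Toeplitz entry into the product of binomials produced by
`tripleSum_eq`. -/
lemma risingProd_mul_shiftedChoose (g d a b : ℕ) :
    risingProd d a * shiftedChoose g d a b * risingProd g b =
      (g + d).factorial * (((d + a).choose b : ℝ) * ((g + b).choose a : ℝ)) := by
  rw [shiftedChoose]
  split_ifs with h
  · by_cases h' : a ≤ g + b
    · rw [risingProd_eq, risingProd_eq, Nat.cast_choose ℝ h, Nat.cast_choose ℝ h',
        Nat.cast_choose ℝ (show d + a - b ≤ g + d by omega),
        show g + d - (d + a - b) = g + b - a by omega, add_comm a d, add_comm b g]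
      have := Nat.factorial_ne_zero
      field_simp
    · rw [Nat.choose_eq_zero_of_lt (show g + d < d + a - b by omega),
        Nat.choose_eq_zero_of_lt (show g + b < a by omega)]
      simp
  · rw [Nat.choose_eq_zero_of_lt (show d + a < b by omega)]
    simp

/-- The Toeplitz matrix of the symbol `(1 - z)^g (1 - 1/z)^d`. -/
noncomputable def signedToeplitz (n g d : ℕ) : Matrix (Fin n) (Fin n) ℝ :=
  Matrix.of fun a b => (-1) ^ (a : ℕ) * shiftedChoose g d a b * (-1) ^ (b : ℕ)

lemma signedToeplitz_factorization (n g d : ℕ) :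
    Matrix.diagonal (fun a : Fin n => risingProd d a) * signedToeplitz n g d *
        Matrix.diagonal (fun a : Fin n => risingProd g a) =
      lowerToeplitz ((1 - PowerSeries.X : PowerSeries ℝ) ^ g) n *
        Matrix.diagonal (fun a : Fin n => risingProd (g + d) a) *
        (lowerToeplitz ((1 - PowerSeries.X : PowerSeries ℝ) ^ d) n)ᵀ := by
  ext a b
  rw [mul_diagonal, diagonal_mul, signedToeplitz, Matrix.of_apply]
  have h := tripleSum_eq n g d a b a.2
  rw [Matrix.mul_apply]
  simp only [mul_diagonal, transpose_apply, lowerToeplitz, Matrix.of_apply]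
  rw [Fin.sum_univ_eq_sum_range (fun r : ℕ =>
    coeffInt ((1 - PowerSeries.X : PowerSeries ℝ) ^ g) ((a : ℕ) - (r : ℕ) : ℤ) *
      risingProd (g + d) r *
      coeffInt ((1 - PowerSeries.X : PowerSeries ℝ) ^ d) ((b : ℕ) - (r : ℕ) : ℤ)) n]
  have h' := risingProd_mul_shiftedChoose g d a b
  calc risingProd d a * ((-1) ^ (a : ℕ) * shiftedChoose g d a b * (-1) ^ (b : ℕ)) * risingProd g b
      = (-1) ^ (a : ℕ) * (-1) ^ (b : ℕ) *
        (risingProd d a * shiftedChoose g d a b * risingProd g b) := by ring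
    _ = (g + d).factorial * tripleSum n (g + d) g d a b := by
      rw [h', h, pow_add]
      ring
    _ = _ := by
      rw [tripleSum, mul_sum]
      refine sum_congr rfl fun r _ => ?_
      rw [risingProd_eq, Nat.cast_choose ℝ (show r ≤ g + d + r by omega),
        show g + d + r - r = g + d by omega, add_comm r (g + d)]
      have := Nat.factorial_ne_zero
      field_simp

lemma det_signedToeplitz (n g d : ℕ) :
    (signedToeplitz n g d).det =
      ∏ r ∈ range n, risingProd (g + d) r / (risingProd d r * risingProd g r) := by
  have h := congrArg Matrix.det (signedToeplitz_factorization n g d)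
  have h1 : ∀ m : ℕ, PowerSeries.coeff 0 ((1 - PowerSeries.X : PowerSeries ℝ) ^ m) = 1 := by
    intro m
    simp
  rw [det_mul, det_mul, det_mul, det_mul, det_transpose, det_diagonal, det_diagonal, det_diagonal,
    det_lowerToeplitz _ (h1 _), det_lowerToeplitz _ (h1 _), one_mul, mul_one,
    Fin.prod_univ_eq_prod_range (fun r => risingProd d r),
    Fin.prod_univ_eq_prod_range (fun r => risingProd g r),
    Fin.prod_univ_eq_prod_range (fun r => risingProd (g + d) r)] at h
  rw [prod_div_distrib, prod_mul_distrib, ← h]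
  have h2 : ∀ m : ℕ, ∏ r ∈ range n, risingProd m r ≠ 0 := fun m =>
    prod_ne_zero_iff.mpr fun r _ => (risingProd_pos m r).ne'
  have := h2 d
  have := h2 g
  field_simp

/-- The power series `(1 - X)^(-m)`. -/
noncomputable def invPow (m : ℕ) : PowerSeries ℝ := (PowerSeries.invOneSubPow ℝ m : PowerSeries ℝ)

lemma one_sub_X_pow_mul_invPow (m : ℕ) :
    (1 - PowerSeries.X : PowerSeries ℝ) ^ m * invPow m = 1 := by
  rw [invPow, ← PowerSeries.invOneSubPow_inv_eq_one_sub_pow]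
  exact (PowerSeries.invOneSubPow ℝ m).inv_mul

/-- From `P T Q = L D U` the inverse is `Q U⁻¹ D⁻¹ L⁻¹ P`; the triangular factors are inverted by
inverting their power series. -/
lemma signedToeplitz_mul_inverse (n g d : ℕ) :
    signedToeplitz n g d *
      (Matrix.diagonal (fun a : Fin n => risingProd g a) * (lowerToeplitz (invPow d) n)ᵀ *
        Matrix.diagonal (fun a : Fin n => (risingProd (g + d) a)⁻¹) *
        lowerToeplitz (invPow g) n * Matrix.diagonal (fun a : Fin n => risingProd d a)) = 1 := by
  have hdiag : ∀ m : ℕ, Matrix.diagonal (fun a : Fin n => (risingProd m a)⁻¹) *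
      Matrix.diagonal (fun a : Fin n => risingProd m a) = 1 := by
    intro m
    rw [diagonal_mul_diagonal]
    simp [inv_mul_cancel₀ (risingProd_pos m _).ne']
  have hdiag' : ∀ m : ℕ, Matrix.diagonal (fun a : Fin n => risingProd m a) *
      Matrix.diagonal (fun a : Fin n => (risingProd m a)⁻¹) = 1 := fun m =>
    mul_eq_one_comm.mp (hdiag m)
  have hL : ∀ m : ℕ, lowerToeplitz ((1 - PowerSeries.X : PowerSeries ℝ) ^ m) n *
      lowerToeplitz (invPow m) n = 1 := by
    intro m
    rw [lowerToeplitz_mul, one_sub_X_pow_mul_invPow, lowerToeplitz_one]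
  have hL' : ∀ m : ℕ, (lowerToeplitz ((1 - PowerSeries.X : PowerSeries ℝ) ^ m) n)ᵀ *
      (lowerToeplitz (invPow m) n)ᵀ = 1 := by
    intro m
    rw [← transpose_mul, mul_eq_one_comm.mp (hL m), transpose_one]
  have hfac := signedToeplitz_factorization n g d
  set P := Matrix.diagonal (fun a : Fin n => risingProd d a)
  set Q := Matrix.diagonal (fun a : Fin n => risingProd g a)
  have hP : P * (signedToeplitz n g d *
      (Q * (lowerToeplitz (invPow d) n)ᵀ *
        Matrix.diagonal (fun a : Fin n => (risingProd (g + d) a)⁻¹) *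
        lowerToeplitz (invPow g) n)) = 1 := by
    simp only [← mul_assoc] at hfac ⊢
    rw [hfac, mul_assoc _ _ (lowerToeplitz (invPow d) n)ᵀ, hL', mul_one, mul_assoc _ _
      (Matrix.diagonal (fun a : Fin n => (risingProd (g + d) a)⁻¹)), hdiag', mul_one, hL]
  rw [← mul_assoc]
  exact mul_eq_one_comm.mp hP

lemma adjugate_signedToeplitz (n g d : ℕ) (p q : Fin n) :
    (signedToeplitz n g d).adjugate p q = (signedToeplitz n g d).det *
      ∑ r ∈ range n, risingProd g p * risingProd d q / risingProd (g + d) r *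
        (coeffInt (invPow d) ((r : ℤ) - (p : ℕ)) * coeffInt (invPow g) ((r : ℤ) - (q : ℕ))) := by
  rw [adjugate_eq_of_mul_eq_one (signedToeplitz_mul_inverse n g d), Matrix.smul_apply, smul_eq_mul,
    mul_diagonal, Matrix.mul_apply, sum_mul]
  simp only [mul_diagonal, diagonal_mul, transpose_apply, lowerToeplitz, Matrix.of_apply]
  congr 1
  rw [← Fin.sum_univ_eq_sum_range (fun r : ℕ =>
    risingProd g p * risingProd d q / risingProd (g + d) r *
      (coeffInt (invPow d) ((r : ℤ) - (p : ℕ)) * coeffInt (invPow g) ((r : ℤ) - (q : ℕ)))) n]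
  refine sum_congr rfl fun r _ => ?_
  ring

end Factorization

end SkewSchurAsymptotics

namespace SkewSchurAsymptotics

open Finset Matrix

/-! ### Complementary minors and the dual Jacobi-Trudi determinant. -/

section DualJacobiTrudi

lemma val_finRotate_pow (n m : ℕ) (i : Fin n) :
    (((finRotate n ^ m) i : Fin n) : ℕ) = (i + m) % n := by
  rcases n with _ | n
  · exact i.elim0
  · induction m with
    | zero => simp [Nat.mod_eq_of_lt i.2]
    | succ m ih =>
      rw [pow_succ', Equiv.Perm.mul_apply, finRotate_apply, Fin.val_add, ih, Fin.val_one',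
        ← Nat.add_mod, add_assoc]

variable {R : Type*} [CommRing R]

lemma det_updateCol_single {n : Type*} [Fintype n] [DecidableEq n] (A : Matrix n n R) (j k : n) :
    (A.updateCol j (Pi.single k 1)).det = A.adjugate j k := by
  rw [← cramer_apply, cramer_eq_adjugate_mulVec, mulVec_single_one, col_apply]

/-- The index `inl j` followed by the indices `inr _`. -/
def borderIndex {N d : ℕ} (j : Fin N) : Fin (d + 1) → Fin N ⊕ Fin d :=
  Fin.cons (Sum.inl j) Sum.inr

@[simp]
lemma borderIndex_zero {N d : ℕ} (j : Fin N) : borderIndex (d := d) j 0 = Sum.inl j := rfl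

@[simp]
lemma borderIndex_succ {N d : ℕ} (j : Fin N) (i : Fin d) :
    borderIndex j i.succ = Sum.inr i := rfl

/-- If `B` is the inverse of `A`, both indexed by `m ⊕ n`, the bordered minor of `B` on rows
`inl j, inr _` and columns `inl k, inr _` is, up to the factor `det A`, a cofactor of the upper
left block of `A`. -/
lemma det_mul_det_bordered {N d : ℕ} (A B : Matrix (Fin N ⊕ Fin d) (Fin N ⊕ Fin d) R)
    (hAB : A * B = 1) (j k : Fin N) :
    A.det * (Matrix.of fun a b : Fin (d + 1) =>
      B (borderIndex j a)
        (borderIndex k b)).det =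
      (Matrix.of fun s t : Fin N => A (Sum.inl s) (Sum.inl t)).adjugate j k := by
  classical
  let q : Fin N ⊕ Fin d → Prop := fun x => x ≠ Sum.inl j ∧ x.isLeft
  -- `W` has identity columns at `inl t` for `t ≠ j`, column `inl k` of `B` at `inl j`, and the
  -- columns of `B` at `inr _`. Its determinant is thus the bordered minor, while `A * W` is block
  -- triangular, its upper left block being that of `A` with column `j` replaced by a unit vector.
  let W : Matrix (Fin N ⊕ Fin d) (Fin N ⊕ Fin d) R := Matrix.of fun x y =>
    if q y then (1 : Matrix (Fin N ⊕ Fin d) (Fin N ⊕ Fin d) R) x y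
    else B x (if y = Sum.inl j then Sum.inl k else y)
  have hWapp : ∀ x y, W x y = if q y then (1 : Matrix (Fin N ⊕ Fin d) (Fin N ⊕ Fin d) R) x y
      else B x (if y = Sum.inl j then Sum.inl k else y) := fun _ _ => rfl
  have hAW : ∀ x y, (A * W) x y = if q y then A x y else
      (1 : Matrix (Fin N ⊕ Fin d) (Fin N ⊕ Fin d) R) x
        (if y = Sum.inl j then Sum.inl k else y) := by
    intro x y
    rw [← hAB]
    by_cases hy : q y
    · rw [if_pos hy, Matrix.mul_apply]
      simp only [W, Matrix.of_apply, if_pos hy, Matrix.one_apply]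
      simp
    · rw [if_neg hy, Matrix.mul_apply, Matrix.mul_apply]
      simp only [W, Matrix.of_apply, if_neg hy]
  have hblocks : A * W = fromBlocks
      ((Matrix.of fun s t : Fin N => A (Sum.inl s) (Sum.inl t)).updateCol j (Pi.single k 1)) 0
      (Matrix.of fun (i : Fin d) (t : Fin N) => (A * W) (Sum.inr i) (Sum.inl t)) 1 := by
    ext x y
    rcases x with s | i <;> rcases y with t | l
    · rw [hAW, fromBlocks_apply₁₁, updateCol_apply]
      by_cases ht : t = j
      · subst ht
        simp [q, Matrix.one_apply, Pi.single_apply]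
      · simp [q, ht]
    · rw [hAW, fromBlocks_apply₁₂]
      simp [q]
    · rw [fromBlocks_apply₂₁, Matrix.of_apply]
    · rw [hAW, fromBlocks_apply₂₂]
      simp [q, Matrix.one_apply]
  have hW : W.det = (Matrix.of fun a b : Fin (d + 1) =>
      B (borderIndex j a)
        (borderIndex k b)).det := by
    rw [twoBlockTriangular_det W q]
    · have h1 : W.toSquareBlockProp q = 1 := by
        ext x y
        rw [toSquareBlockProp_def, Matrix.of_apply, hWapp, if_pos y.2]
        simp [Matrix.one_apply, Subtype.ext_iff]
      have hnot : ∀ a : Fin (d + 1), ¬ q (borderIndex j a) := by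
        intro a
        refine Fin.cases ?_ (fun i => ?_) a
        · simp [q]
        · simp [q]
      let e : Fin (d + 1) ≃ {x // ¬ q x} := Equiv.ofBijective
        (fun a => ⟨(borderIndex j a), hnot a⟩) (by
          constructor
          · intro a b hab
            have hab' := congrArg Subtype.val hab
            revert hab'
            refine Fin.cases ?_ (fun i => ?_) a <;> refine Fin.cases ?_ (fun l => ?_) b <;> simp
          · rintro ⟨x, hx⟩
            rcases x with t | i
            · have ht : t = j := by
                by_contra h
                exact hx ⟨by simpa using h, rfl⟩
              subst ht
              exact ⟨0, by simp⟩
            · exact ⟨i.succ, by simp⟩)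
      rw [h1, det_one, one_mul, ← det_submatrix_equiv_self e]
      congr 1
      ext a b
      rw [submatrix_apply, toSquareBlockProp_def, Matrix.of_apply, hWapp,
        Matrix.of_apply, if_neg (e b).2]
      change B (borderIndex j a) _ = _
      congr 1
      change (if (borderIndex j b) = Sum.inl j then _ else
        (borderIndex j b)) = _
      refine Fin.cases ?_ (fun i => ?_) b <;> simp
    · intro x hx y hy
      simp only [W, Matrix.of_apply, if_pos hy]
      exact Matrix.one_apply_ne fun h => hx (h ▸ hy)
  rw [← hW, ← det_mul, hblocks, det_fromBlocks_zero₁₂, det_one, mul_one, det_updateCol_single]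

/-- The dual form of a Jacobi-Trudi determinant whose rows and columns are consecutive with one
exception each. -/
lemma det_eq_adjugate_toeplitz (f g : PowerSeries R) (hfg : f * g = 1)
    (hf : PowerSeries.coeff 0 f = 1) (N d : ℕ) (j k : Fin (N + 1))
    (X : Matrix (Fin (d + 1)) (Fin (d + 1)) R)
    (hX : ∀ a b, X a b = coeffInt g ((if (a : ℕ) < d then (N : ℤ) + d - (a : ℕ) else (j : ℕ)) -
      (if (b : ℕ) = 0 then (d : ℤ) + (k : ℕ) else d - (b : ℕ)))) :
    X.det = (-1) ^ (d + (N + d) * d) *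
      (Matrix.of fun s t : Fin (N + 1) =>
        coeffInt f ((d : ℤ) + (s : ℕ) - (t : ℕ))).adjugate j k := by
  let c : Fin (N + 1) ⊕ Fin d ≃ Fin (N + 1 + d) := finSumFinEquiv
  -- Rotating the rows by `d` puts rows `d, …, N + d` on top, so the upper left block has entries of
  -- index `d + s - t`. The sign of the rotation is the determinant of `A`.
  let σ : Equiv.Perm (Fin (N + 1 + d)) := finRotate (N + 1 + d) ^ d
  let A := (lowerToeplitz f (N + 1 + d)).submatrix (c.trans σ) c
  let B := (lowerToeplitz g (N + 1 + d)).submatrix c (c.trans σ)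
  have hc : ∀ s : Fin (N + 1), ((c (Sum.inl s) : Fin (N + 1 + d)) : ℕ) = s := fun s => by simp [c]
  have hc' : ∀ i : Fin d, ((c (Sum.inr i) : Fin (N + 1 + d)) : ℕ) = N + 1 + i := fun i => by
    simp [c]
  have hr : ∀ s : Fin (N + 1), (((c.trans σ) (Sum.inl s) : Fin (N + 1 + d)) : ℕ) = d + s := by
    intro s
    rw [Equiv.trans_apply, val_finRotate_pow, hc, Nat.mod_eq_of_lt (by omega), add_comm]
  have hr' : ∀ i : Fin d, (((c.trans σ) (Sum.inr i) : Fin (N + 1 + d)) : ℕ) = i := by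
    intro i
    rw [Equiv.trans_apply, val_finRotate_pow, hc',
      show N + 1 + (i : ℕ) + d = i + (N + 1 + d) by ring, Nat.add_mod_right,
      Nat.mod_eq_of_lt (by omega)]
  have hB : ∀ x y, B x y = coeffInt g (((c x : Fin (N + 1 + d)) : ℤ) -
      (((c.trans σ) y : Fin (N + 1 + d)) : ℤ)) := fun _ _ => rfl
  have hAB : A * B = 1 := by
    rw [submatrix_mul_equiv, lowerToeplitz_mul, hfg, lowerToeplitz_one, submatrix_one_equiv]
  have hdetA : A.det = (-1) ^ ((N + d) * d) := by
    have : A = ((lowerToeplitz f (N + 1 + d)).submatrix σ id).submatrix c c := rfl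
    rw [this, det_submatrix_equiv_self, det_permute, det_lowerToeplitz f hf, map_pow,
      sign_finRotate, ← pow_mul, show N + 1 + d - 1 = N + d by omega]
    simp
  have hmain := det_mul_det_bordered A B hAB j k
  have hcof : (Matrix.of fun s t : Fin (N + 1) => A (Sum.inl s) (Sum.inl t)) =
      Matrix.of fun s t : Fin (N + 1) => coeffInt f ((d : ℤ) + (s : ℕ) - (t : ℕ)) := by
    ext s t
    simp only [A, Matrix.of_apply, submatrix_apply, lowerToeplitz, hc, hr, Nat.cast_add]
  rw [hcof, hdetA] at hmain
  set Y := Matrix.of fun a b : Fin (d + 1) =>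
      B (borderIndex j a)
        (borderIndex k b) with hY
  have hYrow : ∀ a : Fin (d + 1),
      ((c (borderIndex j a) : Fin (N + 1 + d)) : ℤ) =
        if (a : ℕ) = 0 then ((j : ℕ) : ℤ) else (N : ℤ) + (a : ℕ) := by
    intro a
    refine Fin.cases ?_ (fun i => ?_) a
    · simp [hc]
    · simp [hc']
      ring
  have hYcol : ∀ a : Fin (d + 1),
      (((c.trans σ) (borderIndex k a) :
        Fin (N + 1 + d)) : ℤ) = if (a : ℕ) = 0 then (d : ℤ) + (k : ℕ) else (a : ℕ) - 1 := by
    intro a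
    refine Fin.cases ?_ (fun i => ?_) a
    · rw [borderIndex_zero, hr]
      simp
    · rw [borderIndex_succ, hr']
      simp
  -- Jacobi-Trudi lists its rows and columns in decreasing order, the exceptional row last and the
  -- exceptional column first; the bordered minor is increasing with both exceptions first.
  -- Reversing both and rotating the columns once reconciles them, at the cost of the sign `(-1)^d`.
  have hXY : X.submatrix id (finRotate (d + 1)) = Y.submatrix Fin.revPerm Fin.revPerm := by
    ext a b
    rw [submatrix_apply, submatrix_apply, hY, Matrix.of_apply, hX, hB, hYrow, hYcol, Fin.revPerm_apply, Fin.revPerm_apply, Fin.val_rev,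
      Fin.val_rev, coe_finRotate]
    have ha := a.2
    have hb := b.2
    simp only [Fin.ext_iff, Fin.val_last, id_eq]
    congr 1
    split_ifs <;> first | omega | contradiction
  have hdetX : (-1) ^ d * X.det = Y.det := by
    rw [← det_submatrix_equiv_self (Fin.revPerm : Equiv.Perm (Fin (d + 1))) Y, ← hXY, det_permute',
      sign_finRotate]
    simp
  rw [← hdetX, ← mul_assoc] at hmain
  rw [← hmain, ← mul_assoc, pow_add, show (-1 : R) ^ d * (-1) ^ ((N + d) * d) *
    ((-1) ^ ((N + d) * d) * (-1) ^ d) = ((-1) ^ d * (-1) ^ d) *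
      ((-1) ^ ((N + d) * d) * (-1) ^ ((N + d) * d)) by ring, ← mul_pow, ← mul_pow]
  simp

lemma coeffInt_eq_shiftedChoose (g d a b : ℕ) :
    coeffInt ((1 - PowerSeries.X : PowerSeries ℝ) ^ (g + d)) ((d : ℤ) + a - b) =
      (-1) ^ d * ((-1) ^ a * shiftedChoose g d a b * (-1) ^ b) := by
  rw [shiftedChoose]
  split_ifs with h
  · obtain ⟨e, he⟩ := Nat.exists_eq_add_of_le h
    rw [show d + a - b = e by omega, show (d : ℤ) + a - b = (e : ℤ) by omega,
      coeffInt_one_sub_X_pow]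
    have : (-1 : ℝ) ^ d * (-1) ^ a = (-1) ^ b * (-1) ^ e := by rw [← pow_add, he, pow_add]
    have hb : (-1 : ℝ) ^ b * (-1) ^ b = 1 := by rw [← mul_pow]; simp
    calc (-1 : ℝ) ^ e * _ = ((-1) ^ b * (-1) ^ b) * (-1) ^ e * _ := by rw [hb, one_mul]
      _ = ((-1) ^ b * (-1) ^ e) * (-1) ^ b * ((g + d).choose e : ℝ) := by ring
      _ = _ := by
        rw [← this]
        ring
  · rw [coeffInt_of_neg _ (by omega)]
    ring

/-- Reversing rows and columns of a Toeplitz matrix transposes it. This moves the cofactor to the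
bottom right corner, where the sum in `adjugate_signedToeplitz` is short. -/
lemma adjugate_signedToeplitz_rev (N g d : ℕ) (j k : Fin (N + 1)) :
    (signedToeplitz (N + 1) g d).adjugate j k =
      (signedToeplitz (N + 1) g d).adjugate k.rev j.rev := by
  have h : (signedToeplitz (N + 1) g d).submatrix Fin.revPerm Fin.revPerm =
      (signedToeplitz (N + 1) g d)ᵀ := by
    ext a b
    obtain ⟨u, hu⟩ := Nat.exists_eq_add_of_le (Nat.lt_succ_iff.mp a.2)
    obtain ⟨v, hv⟩ := Nat.exists_eq_add_of_le (Nat.lt_succ_iff.mp b.2)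
    have hs : ∀ w : Fin (N + 1), (-1 : ℝ) ^ (N + 1 - ((w : ℕ) + 1)) = (-1) ^ N * (-1) ^ (w : ℕ) := by
      intro w
      have hw := w.2
      rw [← pow_add, show N + (w : ℕ) = N + 1 - (w + 1) + 2 * w by omega, pow_add _ _ (2 * (w : ℕ)),
        pow_mul]
      norm_num
    have hN : (-1 : ℝ) ^ N * (-1) ^ N = 1 := by rw [← mul_pow]; simp
    have hsc : shiftedChoose g d (N + 1 - ((a : ℕ) + 1)) (N + 1 - ((b : ℕ) + 1)) =
        shiftedChoose g d b a := by
      have ha := a.2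
      have hb := b.2
      rw [shiftedChoose, shiftedChoose]
      by_cases h : (a : ℕ) ≤ d + b
      · rw [if_pos h, if_pos (by omega)]
        congr 2
        omega
      · rw [if_neg h, if_neg (by omega)]
    simp only [submatrix_apply, signedToeplitz, Matrix.of_apply, transpose_apply,
      Fin.revPerm_apply, Fin.val_rev, hs, hsc]
    linear_combination ((-1) ^ (a : ℕ) * (-1) ^ (b : ℕ) * shiftedChoose g d b a) * hN
  have h2 := congrArg Matrix.adjugate h
  rw [adjugate_submatrix_equiv_self, ← adjugate_transpose] at h2
  have h3 := congrFun (congrFun h2 k) j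
  rw [transpose_apply] at h3
  rw [← h3]
  rfl

end DualJacobiTrudi

/-! ### The skew Schur polynomial at `1^M` as a cofactor. -/

section SkewSchur

lemma coeff_invPow (m n : ℕ) (hm : 0 < m) :
    PowerSeries.coeff n (invPow m) = ((m + n - 1).choose n : ℝ) := by
  rw [invPow, PowerSeries.invOneSubPow_val_eq_mk_sub_one_add_choose_of_pos _ _ hm,
    PowerSeries.coeff_mk, show m + n - 1 = (m - 1) + n by omega, Nat.choose_symm_add]

lemma eval_one_completeHomogeneous (M : ℕ) (hM : 0 < M) (n : ℤ) :
    MvPolynomial.eval (fun _ : Fin M => (1 : ℝ)) (completeHomogeneous (Fin M) ℝ n) =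
      coeffInt (invPow M) n := by
  rw [completeHomogeneous, coeffInt]
  split_ifs with h
  · rw [coeff_invPow _ _ hM, MvPolynomial.hsymm, map_sum]
    have : ∀ s : Sym (Fin M) n.toNat, MvPolynomial.eval (fun _ : Fin M => (1 : ℝ))
        (s.1.map (MvPolynomial.X : Fin M → MvPolynomial (Fin M) ℝ)).prod = 1 := by
      intro s
      rw [map_multiset_prod, Multiset.map_map]
      refine Multiset.prod_eq_one fun x hx => ?_
      rw [Multiset.mem_map] at hx
      obtain ⟨i, -, rfl⟩ := hx
      simp
    rw [sum_congr rfl fun s _ => this s, sum_const, card_univ, Sym.card_sym_eq_choose,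
      Fintype.card_fin, nsmul_eq_mul, mul_one]
  · simp

lemma eval_one_skewSchur (g d N j k : ℕ) (hM : 0 < g + d) (hj : j ≤ N) (hk : k ≤ N) :
    MvPolynomial.eval (fun _ : Fin (g + d) => (1 : ℝ))
        (skewSchur (Fin (g + d)) ℝ (rectWithRow N d j) [k]) =
      (signedToeplitz (N + 1) g d).adjugate ⟨N - k, by omega⟩ ⟨N - j, by omega⟩ := by
  have hlen : max (rectWithRow N d j).length [k].length = d + 1 := by
    simp [rectWithRow]
  have hmu : ∀ a : ℕ, a < d + 1 → (rectWithRow N d j).getD a 0 = if a < d then N else j := by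
    intro a ha
    rw [rectWithRow]
    split_ifs with h
    · rw [List.getD_append _ _ _ _ (by simpa using h), List.getD_replicate _ h]
    · rw [List.getD_append_right _ _ _ _ (by simpa using h), List.length_replicate,
        show a - d = 0 by omega]
      rfl
  have hnu : ∀ b : ℕ, ([k] : List ℕ).getD b 0 = if b = 0 then k else 0 := by
    intro b
    rcases b with _ | b <;> simp
  rw [skewSchur, RingHom.map_det, ← det_submatrix_equiv_self (finCongr hlen).symm,
    det_eq_adjugate_toeplitz ((1 - PowerSeries.X : PowerSeries ℝ) ^ (g + d)) (invPow (g + d))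
      (one_sub_X_pow_mul_invPow _) (by simp) N d ⟨j, by omega⟩ ⟨k, by omega⟩]
  · have hT : (Matrix.of fun s t : Fin (N + 1) =>
        coeffInt ((1 - PowerSeries.X : PowerSeries ℝ) ^ (g + d)) ((d : ℤ) + (s : ℕ) - (t : ℕ))) =
        (-1 : ℝ) ^ d • signedToeplitz (N + 1) g d := by
      ext s t
      rw [Matrix.of_apply, coeffInt_eq_shiftedChoose]
      rfl
    -- The scalar `(-1)^d` enters the adjugate to the power `N`. With the sign from the dual form
    -- the total exponent is `d(d+1) + 2dN`, which is even.
    rw [hT, adjugate_smul, Matrix.smul_apply, smul_eq_mul, adjugate_signedToeplitz_rev,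
      Fintype.card_fin, Nat.add_sub_cancel, ← mul_assoc, ← pow_mul, ← pow_add,
      show d + (N + d) * d + d * N = d * (d + 1) + 2 * (d * N) by ring,
      Even.neg_one_pow ((Nat.even_mul_succ_self d).add (even_two_mul _)), one_mul]
    congr 1 <;> (ext; simp [Fin.val_rev])
  · intro a b
    rw [submatrix_apply, RingHom.mapMatrix_apply, Matrix.map_apply, Matrix.of_apply,
      eval_one_completeHomogeneous _ hM]
    simp only [finCongr_symm, finCongr_apply, Fin.val_cast]
    rw [hmu _ a.2, hnu]
    congr 1
    have ha := a.2
    split_ifs <;> push_cast <;> omega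

end SkewSchur

end SkewSchurAsymptotics

namespace SkewSchurAsymptotics

open Finset Matrix

/-! ### Vandermonde determinants with one exponent skipped. -/

section Alternants

variable {R : Type*} [CommRing R]

/-- Adjoin the variable `-X` and evaluate the enlarged Vandermonde determinant in two ways: by
expansion along the row of `-X`, and as `∏ (X + z_l)` times the original one. Then compare
coefficients of `X^i`. The choice of `-X` cancels the cofactor signs. -/
lemma det_generalized_vandermonde {N : ℕ} (z : Fin N → R) (i : Fin (N + 1)) :
    (Matrix.of fun m l : Fin N => z l ^ (i.succAbove m : ℕ)).det =
      MvPolynomial.eval z (MvPolynomial.esymm (Fin N) R (N - i)) * (vandermonde z).det := by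
  let v : Fin (N + 1) → Polynomial R := Fin.cons (-Polynomial.X) fun l => Polynomial.C (z l)
  have hprod : (vandermonde v).det =
      (∏ l, (Polynomial.X + Polynomial.C (z l))) * Polynomial.C (vandermonde z).det := by
    rw [det_vandermonde, Fin.prod_univ_succ, Fin.prod_Ioi_zero, det_vandermonde, map_prod]
    congr 1
    · refine prod_congr rfl fun l _ => ?_
      simp only [v, Fin.cons_succ, Fin.cons_zero]
      ring
    · refine prod_congr rfl fun l _ => ?_
      rw [Fin.prod_Ioi_succ, map_prod]
      refine prod_congr rfl fun m _ => ?_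
      simp only [v, Fin.cons_succ, map_sub]
  have hsum : (vandermonde v).det = ∑ m : Fin (N + 1), Polynomial.C
      (Matrix.of fun a l : Fin N => z l ^ (m.succAbove a : ℕ)).det * Polynomial.X ^ (m : ℕ) := by
    rw [det_succ_row_zero]
    refine sum_congr rfl fun m _ => ?_
    have h1 : (vandermonde v).submatrix Fin.succ m.succAbove =
        (Polynomial.C.mapMatrix (Matrix.of fun a l : Fin N => z l ^ (m.succAbove a : ℕ)))ᵀ := by
      ext1 a b
      rw [submatrix_apply, vandermonde_apply, transpose_apply, RingHom.mapMatrix_apply,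
        Matrix.map_apply, Matrix.of_apply, map_pow]
      simp only [v, Fin.cons_succ]
    rw [h1, det_transpose, ← RingHom.map_det, vandermonde_apply]
    simp only [v, Fin.cons_zero]
    rw [← mul_pow, neg_mul_neg, one_mul, mul_comm]
  have h := congrArg (fun q : Polynomial R => q.coeff i) (hsum.symm.trans hprod)
  simp only [Polynomial.finsetSum_coeff, Polynomial.coeff_C_mul, Polynomial.coeff_X_pow,
    Polynomial.coeff_mul_C] at h
  rw [sum_eq_single i (fun m _ hm => by rw [if_neg (fun h => hm (Fin.ext h.symm)), mul_zero])
    (fun hi => absurd (mem_univ i) hi), if_pos rfl, mul_one,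
    Finset.prod_X_add_C_coeff _ _ (by simpa using Nat.lt_succ_iff.mp i.2)] at h
  rw [h, MvPolynomial.esymm, map_sum]
  simp

lemma prod_norm_sub_sq {N : ℕ} (z : Fin N → ℂ) :
    ((∏ p : Fin N × Fin N with p.1 < p.2, ‖z p.1 - z p.2‖ ^ 2 : ℝ) : ℂ) =
      (vandermonde z).det * (vandermonde fun l => (starRingEnd ℂ) (z l)).det := by
  rw [det_vandermonde, det_vandermonde, ← prod_mul_distrib, prod_filter, Fintype.prod_prod_type,
    Complex.ofReal_prod]
  refine prod_congr rfl fun a _ => ?_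
  rw [← prod_filter, filter_lt_eq_Ioi, ← prod_mul_distrib, Complex.ofReal_prod]
  refine prod_congr rfl fun b _ => ?_
  rw [← map_sub, Complex.mul_conj', norm_sub_rev]
  push_cast
  rfl

end Alternants

/-! ### Andréief's integration formula. -/

section Andreief

open MeasureTheory

/-- Expand both determinants over permutations and integrate each product by Fubini. For each fixed
`τ` the sum over `σ` is the same determinant, since the column permutation contributes `sign τ`
twice; hence the factor `N!`. -/
lemma integral_det_mul_det {α : Type*} [MeasurableSpace α] (μ : Measure α) [SigmaFinite μ] {N : ℕ}
    (F G : Fin N → α → ℂ) (hFG : ∀ a b, Integrable (fun x => F a x * G b x) μ) :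
    ∫ θ, (Matrix.of fun m l : Fin N => F m (θ l)).det * (Matrix.of fun m l : Fin N => G m (θ l)).det
        ∂(Measure.pi fun _ : Fin N => μ) =
      N.factorial * (Matrix.of fun a b : Fin N => ∫ x, F a x * G b x ∂μ).det := by
  have hint : ∀ σ τ : Equiv.Perm (Fin N), Integrable
      (fun θ : Fin N → α => ∏ l, F (σ l) (θ l) * G (τ l) (θ l)) (Measure.pi fun _ => μ) :=
    fun σ τ => Integrable.fintype_prod (f := fun l x => F (σ l) x * G (τ l) x)
      fun l => hFG (σ l) (τ l)
  have hexp : ∀ θ : Fin N → α, (Matrix.of fun m l : Fin N => F m (θ l)).det *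
      (Matrix.of fun m l : Fin N => G m (θ l)).det =
      ∑ τ : Equiv.Perm (Fin N), ∑ σ : Equiv.Perm (Fin N),
        (((Equiv.Perm.sign τ : ℤ) : ℂ) * ((Equiv.Perm.sign σ : ℤ) : ℂ)) *
          ∏ l, F (σ l) (θ l) * G (τ l) (θ l) := by
    intro θ
    rw [det_apply', det_apply', sum_mul_sum, sum_comm]
    refine sum_congr rfl fun τ _ => sum_congr rfl fun σ _ => ?_
    rw [prod_mul_distrib]
    simp only [Matrix.of_apply]
    ring
  simp only [hexp]
  rw [integral_finsetSum _ fun τ _ => integrable_finsetSum _ fun σ _ => (hint σ τ).const_mul _]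
  have hτ : ∀ τ : Equiv.Perm (Fin N), ∫ θ : Fin N → α, ∑ σ : Equiv.Perm (Fin N),
        (((Equiv.Perm.sign τ : ℤ) : ℂ) * ((Equiv.Perm.sign σ : ℤ) : ℂ)) *
          ∏ l, F (σ l) (θ l) * G (τ l) (θ l) ∂(Measure.pi fun _ => μ) =
      (Matrix.of fun a b : Fin N => ∫ x, F a x * G b x ∂μ).det := by
    intro τ
    rw [integral_finsetSum _ fun σ _ => (hint σ τ).const_mul _]
    have hperm := det_permute' τ (Matrix.of fun a b : Fin N => ∫ x, F a x * G b x ∂μ)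
    have hsign : ((Equiv.Perm.sign τ : ℤ) : ℂ) * ((Equiv.Perm.sign τ : ℤ) : ℂ) = 1 := by
      rw [← Int.cast_mul, ← Units.val_mul, Int.units_mul_self]
      simp
    rw [← one_mul (Matrix.det _), ← hsign, mul_assoc, ← hperm, det_apply', mul_sum]
    refine sum_congr rfl fun σ _ => ?_
    rw [integral_const_mul, integral_fintype_prod_eq_prod
      (f := fun l x => F (σ l) x * G (τ l) x), mul_assoc]
    rfl
  rw [sum_congr rfl fun τ _ => hτ τ, sum_const, card_univ, Fintype.card_perm, Fintype.card_fin,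
    nsmul_eq_mul]

end Andreief

/-! ### Moments of the weight and the Morris integral as a cofactor. -/

section Weight

open MeasureTheory

/-- Since `1 + e^{iθ} = e^{iθ/2} · 2 cos(θ/2)` and the cosine is nonnegative on this interval, the
modulus is `2 cos(θ/2)` and the half-integer phases combine. -/
lemma morrisWeight_eq (g d : ℕ) {θ : ℝ} (hθ : θ ∈ Set.Icc (-Real.pi) Real.pi) :
    morrisWeight g d θ =
      Complex.exp (-(Complex.I * θ)) ^ d * (1 + Complex.exp (Complex.I * θ)) ^ (g + d) := by
  have hcos : 0 ≤ Real.cos (θ / 2) :=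
    Real.cos_nonneg_of_mem_Icc ⟨by linarith [hθ.1], by linarith [hθ.2]⟩
  have h1 : 1 + Complex.exp (Complex.I * θ) =
      Complex.exp (Complex.I * θ / 2) * ((2 * Real.cos (θ / 2) : ℝ) : ℂ) := by
    rw [Complex.ofReal_mul, Complex.ofReal_cos, Complex.ofReal_ofNat, Complex.two_cos, mul_add,
      ← Complex.exp_add, ← Complex.exp_add, add_comm]
    push_cast
    congr 1
    · ring_nf
    · rw [← Complex.exp_zero]
      ring_nf
  have h2 : ‖1 + Complex.exp (Complex.I * θ)‖ = 2 * Real.cos (θ / 2) := by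
    rw [h1, norm_mul, Complex.norm_real, Real.norm_of_nonneg (by linarith)]
    have : Complex.I * θ / 2 = ((θ / 2 : ℝ) : ℂ) * Complex.I := by push_cast; ring
    rw [this, Complex.norm_exp_ofReal_mul_I, one_mul]
  rw [morrisWeight, h2, h1, mul_pow (Complex.exp _), ← mul_assoc, Complex.ofReal_pow]
  congr 1
  rw [← Complex.exp_nat_mul, ← Complex.exp_nat_mul, ← Complex.exp_add]
  congr 1
  push_cast
  ring

lemma integral_exp_int (n : ℤ) :
    ∫ θ in Set.Icc (-Real.pi) Real.pi, Complex.exp (Complex.I * θ * n) =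
      if n = 0 then 2 * (Real.pi : ℂ) else 0 := by
  rw [integral_Icc_eq_integral_Ioc, ← intervalIntegral.integral_of_le (by linarith [Real.pi_pos])]
  split_ifs with h
  · subst h
    simp
    ring
  · have hc : Complex.I * n ≠ 0 := mul_ne_zero Complex.I_ne_zero (by exact_mod_cast h)
    have e : ∀ θ : ℝ, Complex.I * θ * n = Complex.I * n * θ := fun θ => by ring
    simp only [e]
    rw [integral_exp_mul_complex hc, div_eq_zero_iff]
    left
    rw [sub_eq_zero, Complex.exp_eq_exp_iff_exists_int]
    exact ⟨n, by push_cast; ring⟩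

lemma integral_morrisWeight (g d a b : ℕ) :
    ∫ θ in Set.Icc (-Real.pi) Real.pi, Complex.exp (Complex.I * θ) ^ a *
        (morrisWeight g d θ * Complex.exp (-(Complex.I * θ)) ^ b) =
      2 * (Real.pi : ℂ) * (shiftedChoose g d b a : ℂ) := by
  have h : ∀ θ ∈ Set.Icc (-Real.pi) Real.pi, Complex.exp (Complex.I * θ) ^ a *
        (morrisWeight g d θ * Complex.exp (-(Complex.I * θ)) ^ b) =
      ∑ m ∈ range (g + d + 1), Complex.exp (Complex.I * θ * ((a : ℤ) + m - (d + b) : ℤ)) *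
        ((g + d).choose m : ℂ) := by
    intro θ hθ
    rw [morrisWeight_eq g d hθ, add_comm (1 : ℂ), add_pow, mul_sum, sum_mul, mul_sum]
    refine sum_congr rfl fun m _ => ?_
    have : Complex.exp (Complex.I * θ * ((a : ℤ) + m - (d + b) : ℤ)) =
        Complex.exp (Complex.I * θ) ^ a * Complex.exp (-(Complex.I * θ)) ^ d *
          Complex.exp (Complex.I * θ) ^ m * Complex.exp (-(Complex.I * θ)) ^ b := by
      rw [← Complex.exp_nat_mul, ← Complex.exp_nat_mul, ← Complex.exp_nat_mul,
        ← Complex.exp_nat_mul, ← Complex.exp_add, ← Complex.exp_add, ← Complex.exp_add]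
      congr 1
      push_cast
      ring
    rw [this]
    ring
  rw [setIntegral_congr_fun measurableSet_Icc h, integral_finsetSum]
  · have h2 : ∀ m ∈ range (g + d + 1), ∫ θ in Set.Icc (-Real.pi) Real.pi,
        Complex.exp (Complex.I * θ * ((a : ℤ) + m - (d + b) : ℤ)) * ((g + d).choose m : ℂ) =
        if a + m = d + b then 2 * (Real.pi : ℂ) * ((g + d).choose m : ℂ) else 0 := by
      intro m _
      rw [integral_mul_const, integral_exp_int]
      by_cases hm : a + m = d + b
      · rw [if_pos hm, if_pos (by omega)]
      · rw [if_neg hm, if_neg (by omega), zero_mul]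
    rw [sum_congr rfl h2, shiftedChoose]
    split_ifs with hab
    · by_cases hM : d + b - a < g + d + 1
      · rw [sum_eq_single (d + b - a) (fun m _ hm => if_neg (by omega))
          (fun hn => absurd (mem_range.mpr hM) hn), if_pos (by omega)]
        push_cast
        rfl
      · rw [sum_eq_zero fun m hm => if_neg (by rw [mem_range] at hm; omega),
          Nat.choose_eq_zero_of_lt (by omega)]
        simp
    · rw [sum_eq_zero fun m hm => if_neg (by omega)]
      simp
  · intro m _
    exact (by fun_prop : Continuous _).integrableOn_Icc

lemma continuous_morrisWeight (g d : ℕ) : Continuous (morrisWeight g d) := by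
  unfold morrisWeight
  fun_prop

lemma morrisIntegral_eq (N g d j k : ℕ) (hj : j ≤ N) (hk : k ≤ N) :
    morrisIntegral N g d k j =
      (((signedToeplitz (N + 1) g d).adjugate ⟨N - k, by omega⟩ ⟨N - j, by omega⟩ : ℝ) : ℂ) := by
  set p : Fin (N + 1) := ⟨N - k, by omega⟩ with hp
  set q : Fin (N + 1) := ⟨N - j, by omega⟩ with hq
  have hadj : (signedToeplitz (N + 1) g d).adjugate p q =
      (Matrix.of fun a b : Fin N => shiftedChoose g d (q.succAbove b) (p.succAbove a)).det := by
    -- The moments carry no signs, whereas `signedToeplitz` is their matrix conjugated by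
    -- `diag((-1)^a)`. The conjugation signs cancel exactly the checkerboard sign of the cofactor.
    have h0 := adjugate_conj_sign (Matrix.of fun a b : Fin (N + 1) =>
      shiftedChoose g d a b) (fun a => (-1) ^ (a : ℕ)) (fun i => by rw [← mul_pow]; simp)
    have h0' : (signedToeplitz (N + 1) g d).adjugate p q = _ := congrFun (congrFun h0 p) q
    rw [h0', Matrix.of_apply, adjugate_fin_succ_eq_det_submatrix, ← det_transpose, pow_add]
    have h1 : ∀ n : ℕ, (-1 : ℝ) ^ n * (-1) ^ n = 1 := fun n => by rw [← mul_pow]; simp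
    have h2 : ((Matrix.of fun a b : Fin (N + 1) => shiftedChoose g d a b).submatrix
        q.succAbove p.succAbove)ᵀ =
      Matrix.of fun a b : Fin N => shiftedChoose g d (q.succAbove b) (p.succAbove a) := rfl
    rw [h2]
    linear_combination (Matrix.of fun a b : Fin N =>
      shiftedChoose g d (q.succAbove b) (p.succAbove a)).det *
      ((-1) ^ (q : ℕ) * (-1) ^ (q : ℕ) * h1 p + h1 q)
  let F : Fin N → ℝ → ℂ := fun m θ => Complex.exp (Complex.I * θ) ^ (p.succAbove m : ℕ)
  let G : Fin N → ℝ → ℂ := fun m θ =>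
    morrisWeight g d θ * Complex.exp (-(Complex.I * θ)) ^ (q.succAbove m : ℕ)
  have hinteg : ∀ θ : Fin N → ℝ,
      MvPolynomial.eval (fun l => Complex.exp (Complex.I * (θ l : ℂ)))
          (MvPolynomial.esymm (Fin N) ℂ k) *
        MvPolynomial.eval (fun l => Complex.exp (-(Complex.I * (θ l : ℂ))))
          (MvPolynomial.esymm (Fin N) ℂ j) *
        (∏ l : Fin N, morrisWeight g d (θ l)) *
        ((∏ r : Fin N × Fin N with r.1 < r.2,
          ‖Complex.exp (Complex.I * (θ r.1 : ℂ)) - Complex.exp (Complex.I * (θ r.2 : ℂ))‖ ^ 2 : ℝ) :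
            ℂ) =
      (Matrix.of fun m l : Fin N => F m (θ l)).det *
        (Matrix.of fun m l : Fin N => G m (θ l)).det := by
    intro θ
    have hconj : ∀ l : Fin N, (starRingEnd ℂ) (Complex.exp (Complex.I * (θ l : ℂ))) =
        Complex.exp (-(Complex.I * (θ l : ℂ))) := by
      intro l
      rw [← Complex.exp_conj]
      simp
    have hF := det_generalized_vandermonde (fun l => Complex.exp (Complex.I * (θ l : ℂ))) p
    have hG := det_generalized_vandermonde (fun l => Complex.exp (-(Complex.I * (θ l : ℂ)))) q
    rw [show N - (p : ℕ) = k by simp only [hp]; omega] at hF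
    rw [show N - (q : ℕ) = j by simp only [hq]; omega] at hG
    have hGdet := det_mul_row (fun l => morrisWeight g d (θ l)) (Matrix.of fun m l : Fin N =>
      Complex.exp (-(Complex.I * (θ l : ℂ))) ^ (q.succAbove m : ℕ))
    have hG' : (Matrix.of fun m l : Fin N => G m (θ l)) = Matrix.of fun m l : Fin N =>
      morrisWeight g d (θ l) * (Matrix.of fun m l : Fin N =>
        Complex.exp (-(Complex.I * (θ l : ℂ))) ^ (q.succAbove m : ℕ)) m l := rfl
    rw [prod_norm_sub_sq (fun l => Complex.exp (Complex.I * (θ l : ℂ)))]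
    simp only [hconj]
    rw [hG', hGdet, hG, hF]
    ring
  have hbox : (volume : Measure (Fin N → ℝ)).restrict
      (Set.Icc (fun _ : Fin N => -Real.pi) (fun _ : Fin N => Real.pi)) =
      Measure.pi fun _ : Fin N => (volume : Measure ℝ).restrict (Set.Icc (-Real.pi) Real.pi) := by
    rw [← Set.pi_univ_Icc, volume_pi, Measure.restrict_pi_pi]
  rw [morrisIntegral, hadj]
  simp only [hinteg]
  rw [hbox, integral_det_mul_det _ F G]
  · have hI : (Matrix.of fun a b : Fin N => ∫ x in Set.Icc (-Real.pi) Real.pi, F a x * G b x) =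
        (2 * (Real.pi : ℂ)) • Complex.ofRealHom.mapMatrix
          (Matrix.of fun a b : Fin N => shiftedChoose g d (q.succAbove b) (p.succAbove a)) := by
      ext a b
      exact integral_morrisWeight g d _ _
    rw [hI, det_smul, ← RingHom.map_det, Fintype.card_fin, Complex.ofRealHom_eq_coe]
    have h1 : (N.factorial : ℂ) ≠ 0 := by exact_mod_cast N.factorial_ne_zero
    have h2 : (Real.pi : ℂ) ≠ 0 := by exact_mod_cast Real.pi_ne_zero
    field_simp
  · intro a b
    have hw := continuous_morrisWeight g d
    exact (by fun_prop : Continuous fun x => F a x * G b x).integrableOn_Icc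

end Weight

end SkewSchurAsymptotics

namespace SkewSchurAsymptotics

open Finset Topology

/-! ### Binomial coefficients, determinant asymptotics and the limit. -/

section Coefficients

lemma coeff_zero_invPow (m : ℕ) : PowerSeries.coeff 0 (invPow m) = 1 := by
  have h := congrArg (PowerSeries.coeff 0) (one_sub_X_pow_mul_invPow m)
  simpa using h

lemma coeff_invPow_pos {m n : ℕ} (h : 0 < m ∨ n = 0) :
    0 < PowerSeries.coeff n (invPow m) := by
  rcases Nat.eq_zero_or_pos m with hm | hm
  · rw [h.resolve_left (by omega), coeff_zero_invPow]
    exact one_pos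
  · rw [coeff_invPow _ _ hm]
    exact_mod_cast Nat.choose_pos (by omega)

/-- The case `m = n = 0` is the convention `C(-1, 0) = 1`, needed for `d = M` and `j = 0`. -/
lemma ringChoose_eq_coeff_invPow {m n r : ℕ} {x : ℤ} (h : 0 < m ∨ n = 0) (hr : r ≤ n)
    (hx : x = (m : ℤ) + n - r - 1) :
    ((Ring.choose x (n - r) : ℤ) : ℝ) = PowerSeries.coeff (n - r) (invPow m) := by
  rcases Nat.eq_zero_or_pos m with hm | hm
  · rw [show n - r = 0 by omega, coeff_zero_invPow, Ring.choose_zero_right, Int.cast_one]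
  · rw [coeff_invPow _ _ hm, hx, show (m : ℤ) + n - r - 1 = ((m + (n - r) - 1 : ℕ) : ℤ) by omega,
      Ring.choose_natCast, Int.cast_natCast]

end Coefficients

section Determinant

lemma risingProd_add (g d n : ℕ) :
    risingProd (g + d) n = risingProd d n * risingProd g (n + d) := by
  rw [risingProd_eq, risingProd_eq, risingProd_eq, show n + (g + d) = n + d + g by ring]
  have := Nat.factorial_ne_zero
  field_simp

/-- Trades a product of growing length `n` for one of fixed length `d`, so that the limit can be
taken factor by factor. By `risingProd_add` the `n`-th factor is `risingProd g (n + d) / risingProd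
g n`, which slides the window `n, …, n + d - 1` by one. -/
lemma prod_risingProd_div (g d n : ℕ) :
    ∏ r ∈ range n, risingProd (g + d) r / (risingProd d r * risingProd g r) =
      ∏ i ∈ range d, risingProd g (n + i) * ((i.factorial : ℝ) / (g + i).factorial) := by
  induction n with
  | zero =>
    symm
    rw [range_zero, prod_empty]
    refine prod_eq_one fun i _ => ?_
    rw [risingProd_eq, zero_add, add_comm i g]
    have := Nat.factorial_ne_zero
    field_simp
  | succ n ih =>
    have ht : (∏ i ∈ range d, risingProd g (n + 1 + i)) * risingProd g n =
        (∏ i ∈ range d, risingProd g (n + i)) * risingProd g (n + d) := by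
      rw [← prod_range_succ (fun i => risingProd g (n + i)), prod_range_succ' _ d, add_zero]
      congr 1
      exact prod_congr rfl fun i _ => by rw [add_assoc, add_comm 1 i]
    rw [prod_range_succ, ih, prod_mul_distrib, prod_mul_distrib, risingProd_add]
    have h1 := (risingProd_pos g n).ne'
    have h2 := (risingProd_pos d n).ne'
    rw [eq_div_of_mul_eq h1 ht]
    field_simp

lemma barnesG_quotient (g d : ℕ) :
    (barnesG (d + 1) : ℝ) * barnesG (g + 1) / barnesG (g + d + 1) =
      ∏ i ∈ range d, ((i.factorial : ℝ) / (g + i).factorial) := by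
  simp only [barnesG, Nat.add_sub_cancel]
  rw [prod_range_add, prod_div_distrib]
  push_cast
  have h : ∀ (n : ℕ) (s : ℕ → ℕ), (∏ i ∈ range n, ((s i).factorial : ℝ)) ≠ 0 := fun n s =>
    prod_ne_zero_iff.mpr fun i _ => by exact_mod_cast (s i).factorial_ne_zero
  have h1 := h g id
  have h2 := h d fun i => g + i
  simp only [id] at h1
  field_simp

end Determinant

section Limits

lemma tendsto_risingProd_div_pow (g : ℕ) (s : ℕ → ℕ) (c : ℝ)
    (hs : ∀ᶠ N : ℕ in atTop, (s N : ℝ) = N + c) :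
    Tendsto (fun N : ℕ => risingProd g (s N) / (N : ℝ) ^ g) atTop (𝓝 1) := by
  have h : Tendsto (fun N : ℕ => ∏ i ∈ range g, (1 + (c + 1 + i) * (N : ℝ)⁻¹)) atTop (𝓝 1) := by
    have h1 : ∀ i ∈ range g,
        Tendsto (fun N : ℕ => 1 + (c + 1 + i) * (N : ℝ)⁻¹) atTop (𝓝 (1 + (c + 1 + i) * 0)) :=
      fun i _ => (tendsto_inv_atTop_nhds_zero_nat.const_mul _).const_add _
    have h2 := tendsto_finsetProd _ h1
    simpa using h2
  refine h.congr' ?_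
  filter_upwards [hs, eventually_gt_atTop 0] with N hN hpos
  have hN0 : (N : ℝ) ≠ 0 := by exact_mod_cast hpos.ne'
  rw [risingProd, Nat.ascFactorial_eq_prod_range, Nat.cast_prod]
  have hpow : (N : ℝ) ^ g = ∏ _i ∈ range g, (N : ℝ) := by rw [prod_const, card_range]
  rw [hpow, ← prod_div_distrib]
  refine prod_congr rfl fun i _ => ?_
  push_cast
  rw [hN]
  field_simp
  ring

lemma tendsto_det_signedToeplitz (g d : ℕ) :
    Tendsto (fun N : ℕ => (signedToeplitz (N + 1) g d).det / (N : ℝ) ^ (d * g)) atTop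
      (𝓝 ((barnesG (d + 1) : ℝ) * barnesG (g + 1) / barnesG (g + d + 1))) := by
  have h : ∀ i ∈ range d, Tendsto (fun N : ℕ => risingProd g (N + 1 + i) / (N : ℝ) ^ g *
      ((i.factorial : ℝ) / (g + i).factorial)) atTop
      (𝓝 (1 * ((i.factorial : ℝ) / (g + i).factorial))) := fun i _ =>
    (tendsto_risingProd_div_pow g (fun N => N + 1 + i) (1 + i)
      (Eventually.of_forall fun N => by push_cast; ring)).mul_const _
  have h2 := tendsto_finsetProd _ h
  simp only [one_mul] at h2
  rw [barnesG_quotient]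
  refine h2.congr fun N => ?_
  rw [det_signedToeplitz, prod_risingProd_div, mul_comm d g, pow_mul]
  have hpow : ((N : ℝ) ^ g) ^ d = ∏ _i ∈ range d, (N : ℝ) ^ g := by rw [prod_const, card_range]
  rw [hpow, ← prod_div_distrib]
  exact prod_congr rfl fun i _ => by ring

/-- Substituting `r ↦ N - r` turns the coefficient indices into `k - r` and `j - r`, which are
negative beyond `min j k`. The sum then has a length independent of `N`. -/
lemma sum_coeffInt_invPow (g d j k N : ℕ) (hj : j ≤ N) (hk : k ≤ N) :
    ∑ r ∈ range (N + 1), risingProd g (N - k) * risingProd d (N - j) / risingProd (g + d) r *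
        (coeffInt (invPow d) ((r : ℤ) - (N - k : ℕ)) * coeffInt (invPow g) ((r : ℤ) - (N - j : ℕ))) =
      ∑ r ∈ range (min j k + 1),
        risingProd g (N - k) * risingProd d (N - j) / risingProd (g + d) (N - r) *
          (PowerSeries.coeff (j - r) (invPow g) * PowerSeries.coeff (k - r) (invPow d)) := by
  rw [← sum_range_reflect]
  have hsub : range (min j k + 1) ⊆ range (N + 1) := by
    intro r hr
    rw [mem_range] at hr ⊢
    omega
  rw [← sum_subset hsub]
  · refine sum_congr rfl fun r hr => ?_
    rw [mem_range] at hr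
    rw [show N + 1 - 1 - r = N - r by omega,
      show ((N - r : ℕ) : ℤ) - (N - k : ℕ) = ((k - r : ℕ) : ℤ) by omega,
      show ((N - r : ℕ) : ℤ) - (N - j : ℕ) = ((j - r : ℕ) : ℤ) by omega, coeffInt_natCast,
      coeffInt_natCast, mul_comm (PowerSeries.coeff (k - r) (invPow d))]
  · intro r hr hr'
    rw [mem_range] at hr hr'
    rcases lt_or_ge k r with h | h
    · rw [coeffInt_of_neg (invPow d) (by omega), zero_mul, mul_zero]
    · rw [coeffInt_of_neg (invPow g) (by omega), mul_zero, mul_zero]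

lemma eventually_sub_cast (c : ℕ) :
    ∀ᶠ N : ℕ in atTop, ((N - c : ℕ) : ℝ) = (N : ℝ) + -(c : ℝ) := by
  filter_upwards [eventually_ge_atTop c] with N hN
  rw [Nat.cast_sub hN, sub_eq_add_neg]

lemma tendsto_risingProd_quotient (g d j k r : ℕ) :
    Tendsto (fun N : ℕ =>
      risingProd g (N - k) * risingProd d (N - j) / risingProd (g + d) (N - r)) atTop (𝓝 1) := by
  have h1 := tendsto_risingProd_div_pow g (fun N => N - k) _ (eventually_sub_cast k)
  have h2 := tendsto_risingProd_div_pow d (fun N => N - j) _ (eventually_sub_cast j)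
  have h3 := tendsto_risingProd_div_pow (g + d) (fun N => N - r) _ (eventually_sub_cast r)
  have h := (h1.mul h2).div h3 one_ne_zero
  rw [one_mul, div_one] at h
  refine h.congr' ?_
  filter_upwards [eventually_gt_atTop 0] with N hN
  have hN0 : (N : ℝ) ≠ 0 := by exact_mod_cast hN.ne'
  have := (risingProd_pos (g + d) (N - r)).ne'
  simp only [Pi.div_apply]
  rw [pow_add]
  field_simp

lemma isEquivalent_of_eq_adjugate (g d j k : ℕ) (hd : 0 < d) (hg : 0 < g ∨ j = 0)
    (V : ℕ → ℝ) (hV : ∀ (N : ℕ) (_ : j ≤ N) (_ : k ≤ N), V N =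
      (signedToeplitz (N + 1) g d).adjugate ⟨N - k, by omega⟩ ⟨N - j, by omega⟩) :
    V ~[atTop] fun N : ℕ => (N : ℝ) ^ (d * g) *
      ((barnesG (d + 1) : ℝ) * barnesG (g + 1) / barnesG (g + d + 1)) *
        ∑ r ∈ range (min j k + 1),
          PowerSeries.coeff (j - r) (invPow g) * PowerSeries.coeff (k - r) (invPow d) := by
  set S := ∑ r ∈ range (min j k + 1),
    PowerSeries.coeff (j - r) (invPow g) * PowerSeries.coeff (k - r) (invPow d) with hS
  set C := (barnesG (d + 1) : ℝ) * barnesG (g + 1) / barnesG (g + d + 1) with hC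
  -- Convergence to a constant gives asymptotic equivalence only if the constant is nonzero. When `g
  -- = 0` the coefficients of `invPow g` in positive degree vanish, so `j = 0` is what keeps the
  -- terms positive.
  have hSpos : 0 < S := sum_pos
    (fun r _ => mul_pos (coeff_invPow_pos (by omega)) (coeff_invPow_pos (Or.inl hd)))
    ⟨0, by simp⟩
  have hCpos : 0 < C := by
    rw [hC, barnesG_quotient]
    exact prod_pos fun i _ => by positivity
  have hsum : Tendsto (fun N : ℕ => ∑ r ∈ range (min j k + 1),
      risingProd g (N - k) * risingProd d (N - j) / risingProd (g + d) (N - r) *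
        (PowerSeries.coeff (j - r) (invPow g) * PowerSeries.coeff (k - r) (invPow d))) atTop
      (𝓝 S) := by
    have := tendsto_finsetSum (range (min j k + 1)) fun r _ =>
      (tendsto_risingProd_quotient g d j k r).mul_const
        (PowerSeries.coeff (j - r) (invPow g) * PowerSeries.coeff (k - r) (invPow d))
    simpa only [one_mul] using this
  have hlim := (isEquivalent_const_iff_tendsto (mul_pos hCpos hSpos).ne').mpr
    ((tendsto_det_signedToeplitz g d).mul hsum)
  have hmul := (IsEquivalent.refl (u := fun N : ℕ => (N : ℝ) ^ (d * g)) (l := atTop)).mul hlim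
  refine (hmul.congr_left ?_).congr_right (Eventually.of_forall fun N => ?_)
  · filter_upwards [eventually_gt_atTop 0, eventually_ge_atTop j, eventually_ge_atTop k]
      with N hN hj hk
    have hN0 : (N : ℝ) ≠ 0 := by exact_mod_cast hN.ne'
    rw [hV N hj hk, adjugate_signedToeplitz, sum_coeffInt_invPow g d j k N hj hk, Pi.mul_apply]
    field_simp
  · simp only [Pi.mul_apply, Function.const_apply]
    ring

lemma isEquivalent_ofReal {u v : ℕ → ℝ} (h : u ~[atTop] v) :
    (fun N => (u N : ℂ)) ~[atTop] fun N => (v N : ℂ) := by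
  have h' : (fun N => ((u N - v N : ℝ) : ℂ)) =o[atTop] fun N => (v N : ℂ) :=
    IsLittleO.of_norm_norm (by
      simpa only [Complex.norm_real, Pi.sub_apply] using h.isLittleO.norm_norm)
  exact h'.congr_left fun N => by simp

end Limits

end SkewSchurAsymptotics

theorem mainTheorem10 (M d j k : ℕ) (hd : 1 ≤ d) (hM : d < M ∨ (d = M ∧ j = 0)) :
    (fun N : ℕ => MvPolynomial.eval (fun _ : Fin M => (1 : ℝ))
        (SkewSchurAsymptotics.skewSchur (Fin M) ℝ
          (SkewSchurAsymptotics.rectWithRow N d j) [k]))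
      ~[atTop]
      (fun N : ℕ => (N : ℝ) ^ (d * (M - d)) *
        ((SkewSchurAsymptotics.barnesG (d + 1) : ℝ) * SkewSchurAsymptotics.barnesG (M - d + 1) /
          SkewSchurAsymptotics.barnesG (M + 1)) *
        ∑ r ∈ Finset.range (min j k + 1),
          ((Ring.choose ((M : ℤ) - d + j - r - 1) (j - r) : ℤ) : ℝ) *
            ((Ring.choose ((d : ℤ) + k - r - 1) (k - r) : ℤ) : ℝ)) ∧
    (fun N : ℕ => SkewSchurAsymptotics.morrisIntegral N (M - d) d k j)
      ~[atTop]
      (fun N : ℕ => (N : ℂ) ^ (d * (M - d)) *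
        ((SkewSchurAsymptotics.barnesG (d + 1) : ℂ) * SkewSchurAsymptotics.barnesG (M - d + 1) /
          SkewSchurAsymptotics.barnesG (M + 1)) *
        ∑ r ∈ Finset.range (min j k + 1),
          ((Ring.choose ((M : ℤ) - d + j - r - 1) (j - r) : ℤ) : ℂ) *
            ((Ring.choose ((d : ℤ) + k - r - 1) (k - r) : ℤ) : ℂ)) := by
  obtain ⟨g, rfl⟩ : ∃ g, M = g + d := ⟨M - d, by omega⟩
  have hg : 0 < g ∨ j = 0 := by omega
  have hchoose : ∀ r ∈ Finset.range (min j k + 1),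
      ((Ring.choose (((g + d : ℕ) : ℤ) - d + j - r - 1) (j - r) : ℤ) : ℝ) *
        ((Ring.choose ((d : ℤ) + k - r - 1) (k - r) : ℤ) : ℝ) =
      PowerSeries.coeff (j - r) (SkewSchurAsymptotics.invPow g) *
        PowerSeries.coeff (k - r) (SkewSchurAsymptotics.invPow d) := by
    intro r hr
    rw [Finset.mem_range] at hr
    rw [SkewSchurAsymptotics.ringChoose_eq_coeff_invPow hg (by omega) (by push_cast; ring),
      SkewSchurAsymptotics.ringChoose_eq_coeff_invPow (Or.inl hd) (by omega) rfl]
  have key := fun V hV => SkewSchurAsymptotics.isEquivalent_of_eq_adjugate g d j k hd hg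
    V hV
  rw [← Finset.sum_congr rfl hchoose] at key
  rw [Nat.add_sub_cancel]
  refine ⟨key _ fun N hj hk =>
    SkewSchurAsymptotics.eval_one_skewSchur g d N j k (by omega) hj hk, ?_⟩
  have hcomplex := SkewSchurAsymptotics.isEquivalent_ofReal (key _ fun N hj hk =>
    SkewSchurAsymptotics.eval_one_skewSchur g d N j k (by omega) hj hk)
  refine (hcomplex.congr_left ?_).congr_right (Eventually.of_forall fun N => ?_)
  · filter_upwards [eventually_ge_atTop j, eventually_ge_atTop k] with N hj hk
    rw [SkewSchurAsymptotics.morrisIntegral_eq N g d j k hj hk,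
      SkewSchurAsymptotics.eval_one_skewSchur g d N j k (by omega) hj hk]
  · push_cast
    rfl
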